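/- There is a polynomial-time algorithm that solves the following problem. The input is a triple $(G,(C',I'))$, where $G=(V,E)$ is a finite simple undirected graph on $n$ vertices, and $C',I'\subseteq V$ are vertex subsets such that $C'$ is a vertex modulator of $G$ to chair-free graphs, that is, the graph $G-C'$ has no induced subgraph isomorphic to the chair (the graph on the vertices $a,b,c,d,e$ with the edges $ab,bc,bd,de$). The algorithm decides whether $G$ has a monopolar partition that extends $(C',I')$, that is, a partition $V=C\uplus I$ (parts may be empty) such that every connected component of $G[C]$ is a complete graph, $I$ is an independent set in $G$, $C'\subseteq C$ and $I'\subseteq I$. If $G$ has such a partition, then the algorithm also outputs one. Precisely: there are a single program of a random access machine (with addition, truncated subtraction and comparison as its unit-cost arithmetic operations) and a polynomial $p$ such that on every such input the program halts after at most $p(n)$ steps, answers Yes and outputs such a partition if one exists, and answers No otherwise. -/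

import Mathlib

/-! ### A random access machine with a step count -/

namespace RAM

/-- A memory state: scalar variables, and two-dimensional arrays of natural numbers.
A program mentions only finitely many variables and arrays. -/
@[ext]
structure State where
  /-- `var x` is the value of the scalar variable `x`. -/
  var : ℕ → ℕ
  /-- `arr a i j` is the entry of the array `a` in row `i` and column `j`. -/
  arr : ℕ → ℕ → ℕ → ℕ

/-- Expressions. The only arithmetic is addition, truncated subtraction and comparison (there is
no multiplication), so that a number grows by at most one bit with each operation, and a
unit-cost count of the operations is polynomially related to Turing machine time. -/
inductive Expr : Type
  | const (k : ℕ)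
  | var (x : ℕ)
  | load (a : ℕ) (i j : Expr)
  | add (e f : Expr)
  | sub (e f : Expr)
  | eq (e f : Expr)
  | lt (e f : Expr)

/-- The value of an expression; comparisons yield `1` if they hold and `0` if they do not. -/
def Expr.eval (s : State) : Expr → ℕ
  | .const k => k
  | .var x => s.var x
  | .load a i j => s.arr a (i.eval s) (j.eval s)
  | .add e f => e.eval s + f.eval s
  | .sub e f => e.eval s - f.eval s
  | .eq e f => if e.eval s = f.eval s then 1 else 0
  | .lt e f => if e.eval s < f.eval s then 1 else 0

/-- The number of operations, memory accesses included, performed to evaluate an expression. -/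
def Expr.cost : Expr → ℕ
  | .const _ => 1
  | .var _ => 1
  | .load _ i j => i.cost + j.cost + 1
  | .add e f => e.cost + f.cost + 1
  | .sub e f => e.cost + f.cost + 1
  | .eq e f => e.cost + f.cost + 1
  | .lt e f => e.cost + f.cost + 1

/-- The state after the value `v` is assigned to the variable `x`. -/
def State.setVar (s : State) (x v : ℕ) : State where
  var := fun y => if y = x then v else s.var y
  arr := s.arr

/-- The state after the value `v` is stored in row `i` and column `j` of the array `a`. -/
def State.setArr (s : State) (a i j v : ℕ) : State where
  var := s.var
  arr := fun b k l => if b = a ∧ k = i ∧ l = j then v else s.arr b k l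

/-- Programs. -/
inductive Prog : Type
  | skip
  | assign (x : ℕ) (e : Expr)
  | store (a : ℕ) (i j e : Expr)
  | seq (P Q : Prog)
  | ite (e : Expr) (P Q : Prog)
  | loop (e : Expr) (P : Prog)

/-- `Exec P s t s'`: the program `P`, started in the state `s`, halts in the state `s'` after
exactly `t` steps. A condition counts as true if its value is not `0`; `loop e P` is
"while `e` do `P`". -/
inductive Exec : Prog → State → ℕ → State → Prop
  | skip (s : State) : Exec .skip s 1 s
  | assign (s : State) (x : ℕ) (e : Expr) :
      Exec (.assign x e) s (e.cost + 1) (s.setVar x (e.eval s))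
  | store (s : State) (a : ℕ) (i j e : Expr) :
      Exec (.store a i j e) s (i.cost + j.cost + e.cost + 1)
        (s.setArr a (i.eval s) (j.eval s) (e.eval s))
  | seq {P Q : Prog} {s₁ s₂ s₃ : State} {t u : ℕ} :
      Exec P s₁ t s₂ → Exec Q s₂ u s₃ → Exec (.seq P Q) s₁ (t + u) s₃
  | ite_true {e : Expr} {P Q : Prog} {s s' : State} {t : ℕ} :
      e.eval s ≠ 0 → Exec P s t s' → Exec (.ite e P Q) s (e.cost + 1 + t) s'
  | ite_false {e : Expr} {P Q : Prog} {s s' : State} {t : ℕ} :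
      e.eval s = 0 → Exec Q s t s' → Exec (.ite e P Q) s (e.cost + 1 + t) s'
  | loop_true {e : Expr} {P : Prog} {s₁ s₂ s₃ : State} {t u : ℕ} :
      e.eval s₁ ≠ 0 → Exec P s₁ t s₂ → Exec (.loop e P) s₂ u s₃ →
        Exec (.loop e P) s₁ (e.cost + 1 + t + u) s₃
  | loop_false {e : Expr} {P : Prog} {s : State} :
      e.eval s = 0 → Exec (.loop e P) s (e.cost + 1) s

end RAM

/-! ### Monopolar partitions and chairs -/

namespace Monopolar

variable {V : Type*}

/-- A cluster graph: every connected component is a complete graph. -/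
def IsClusterGraph (G : SimpleGraph V) : Prop :=
  ∀ K : G.ConnectedComponent, G.IsClique K.supp

/-- `V = C ⊎ I` is a monopolar partition of `G` (a part may be empty). -/
def IsMonopolarPartition (G : SimpleGraph V) (C I : Set V) : Prop :=
  Disjoint C I ∧ C ∪ I = Set.univ ∧ IsClusterGraph (G.induce C) ∧ G.IsIndepSet I

/-- The monopolar partition `V = C ⊎ I` of `G` extends the pair `(C', I')`. -/
def IsMonopolarExtension (G : SimpleGraph V) (C' I' C I : Set V) : Prop :=
  IsMonopolarPartition G C I ∧ C' ⊆ C ∧ I' ⊆ I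

/-- `G` is `(C', I')`-monopolar extendable. -/
def MonopolarExtendable (G : SimpleGraph V) (C' I' : Set V) : Prop :=
  ∃ C I : Set V, IsMonopolarExtension G C' I' C I

/-- The chair: the vertex `1` is adjacent to `0`, `2`, `3`, and `3` is also adjacent to `4`. -/
def chair : SimpleGraph (Fin 5) :=
  SimpleGraph.fromEdgeSet {s(0, 1), s(1, 2), s(1, 3), s(3, 4)}

/-- `G` has no induced subgraph isomorphic to the chair. -/
def IsChairFree (G : SimpleGraph V) : Prop :=
  ¬ chair.IsIndContained G

/-- `X` is a vertex modulator of `G` to chair-free graphs: `G - X` is chair-free. -/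
def IsChairFreeModulator (G : SimpleGraph V) (X : Set V) : Prop :=
  IsChairFree (G.induce Xᶜ)

/-! ### Input and output of an algorithm for Monopolar Extension -/

open Classical in
/-- The initial state for the input `(G, (C', I'))`, where `G` has the vertices `0, …, n - 1`:
the variable `0` holds `n`, the array `0` holds the adjacency matrix of `G`, and the arrays `1`
and `2` hold, in column `0`, the characteristic vectors of `C'` and `I'`. All else is `0`. -/
noncomputable def inputState {n : ℕ} (G : SimpleGraph (Fin n)) (C' I' : Set (Fin n)) :
    RAM.State where
  var := fun x => if x = 0 then n else 0
  arr := fun a i j =>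
    if a = 0 ∧ ∃ u v : Fin n, (u : ℕ) = i ∧ (v : ℕ) = j ∧ G.Adj u v then 1
    else if a = 1 ∧ j = 0 ∧ ∃ v ∈ C', (v : ℕ) = i then 1
    else if a = 2 ∧ j = 0 ∧ ∃ v ∈ I', (v : ℕ) = i then 1
    else 0

/-- The final state answers "Yes": the variable `1` holds `1`. -/
def AnswersYes (s : RAM.State) : Prop := s.var 1 = 1

/-- The final state answers "No": the variable `1` holds `0`. -/
def AnswersNo (s : RAM.State) : Prop := s.var 1 = 0

/-- The final state outputs the partition `(C, I)`: in column `0` of the array `3`, the vertices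
of `C` have the entry `1` and those of `I` have the entry `0`. -/
def OutputsPartition {n : ℕ} (s : RAM.State) (C I : Set (Fin n)) : Prop :=
  (∀ v ∈ C, s.arr 3 v 0 = 1) ∧ (∀ v ∈ I, s.arr 3 v 0 = 0)

end Monopolar

/-! An independent set that avoids `C'` and contains `I'` gives an extension exactly when it meets
every induced path a, b, c. This is a clause with three literals; the point is that two literals
suffice.

If the middle vertex b lies in `C'`, has a neighbour in `C'`, dominates a path, or lies in a
triangle, the path is excluded by `PathConflict`, `PawConflict` and `ForcedConflict`, which hold in
every extension. Otherwise, suppose the independent part cannot be enlarged outside `C'`. Then b has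
a neighbour w in it, hence three neighbours a, c, w, and `ClawConflict` excludes a and b from being
together in the cluster part. So any solution of the clauses, enlarged greedily, is an extension
(`SatisfiesClauses.isMonopolarExtension`). Conversely, an extension with maximal independent part
satisfies `ClawConflict` too, since a violation would yield a chair outside `C'`
(`MonopolarExtendable.exists_satisfiesClauses`). Only this converse needs the modulator.

The clauses are solved by closing the implications between literals under transitivity, rejecting if
some variable is equivalent to its negation, and otherwise fixing the variables one by one while
preserving closure and consistency.

Every phase is a fixed nest of loops of length n or 2n that writes ones, so `LoopProg.exec_compile`
bounds the time once and for all, and correctness is a statement about `LoopProg.den`. -/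

namespace RAM

/-! ### Boolean expressions -/

namespace Expr

/-- The value of the expression counts as true. -/
def Holds (s : State) (e : Expr) : Prop := e.eval s ≠ 0

/-- Negation. -/
def not (e : Expr) : Expr := .eq e (.const 0)

/-- Conjunction. -/
def and (e f : Expr) : Expr := not (.add (not e) (not f))

/-- Disjunction. -/
def or (e f : Expr) : Expr := .add e f

variable (s : State)

@[simp] theorem holds_not (e : Expr) : Holds s (not e) ↔ ¬ Holds s e := by
  by_cases h : e.eval s = 0 <;> simp [Holds, not, eval, h]

@[simp] theorem holds_and (e f : Expr) : Holds s (and e f) ↔ Holds s e ∧ Holds s f := by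
  by_cases h : e.eval s = 0 <;> by_cases h' : f.eval s = 0 <;> simp [Holds, not, and, eval, h, h']

@[simp] theorem holds_or (e f : Expr) : Holds s (or e f) ↔ Holds s e ∨ Holds s f := by
  simp only [Holds, or, eval]
  omega

@[simp] theorem holds_eq (e f : Expr) : Holds s (.eq e f) ↔ e.eval s = f.eval s := by
  simp [Holds, eval]

@[simp] theorem holds_load (a : ℕ) (i j : Expr) :
    Holds s (.load a i j) ↔ s.arr a (i.eval s) (j.eval s) ≠ 0 := by
  simp [Holds, eval]

@[simp] theorem holds_const (k : ℕ) : Holds s (.const k) ↔ k ≠ 0 := by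
  simp [Holds, eval]

@[simp] theorem eval_var (x : ℕ) : eval s (.var x) = s.var x := rfl

@[simp] theorem eval_const (k : ℕ) : eval s (.const k) = k := rfl

@[simp] theorem eval_add (e f : Expr) : eval s (.add e f) = e.eval s + f.eval s := rfl

/-- The expression does not read the array `a`. -/
def Avoids (a : ℕ) : Expr → Prop
  | .const _ => True
  | .var _ => True
  | .load b i j => b ≠ a ∧ i.Avoids a ∧ j.Avoids a
  | .add e f => e.Avoids a ∧ f.Avoids a
  | .sub e f => e.Avoids a ∧ f.Avoids a
  | .eq e f => e.Avoids a ∧ f.Avoids a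
  | .lt e f => e.Avoids a ∧ f.Avoids a

theorem Avoids.eval_congr {a : ℕ} {env : ℕ → ℕ} {A B : ℕ → ℕ → ℕ → ℕ}
    (h : ∀ b, b ≠ a → A b = B b) : ∀ {e : Expr}, e.Avoids a → e.eval ⟨env, A⟩ = e.eval ⟨env, B⟩
  | .const _, _ => rfl
  | .var _, _ => rfl
  | .load b i j, he => by
      simp only [eval, h b he.1, he.2.1.eval_congr h, he.2.2.eval_congr h]
  | .add e f, he => by simp only [eval, he.1.eval_congr h, he.2.eval_congr h]
  | .sub e f, he => by simp only [eval, he.1.eval_congr h, he.2.eval_congr h]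
  | .eq e f, he => by simp only [eval, he.1.eval_congr h, he.2.eval_congr h]
  | .lt e f, he => by simp only [eval, he.1.eval_congr h, he.2.eval_congr h]

end Expr

/-! ### Loop programs -/

/-- The contents of the arrays. -/
abbrev Arrays := ℕ → ℕ → ℕ → ℕ

/-- Programs that enter ones into arrays inside nested loops of length `n` or `2 * n`, where `n`
is the value of the variable `0` and the variable `2` holds `2 * n`. -/
inductive LoopProg : Type
  | mark (e : Expr) (a : ℕ) (i j : Expr)
  | seq (p q : LoopProg)
  | loop (double : Bool) (p : LoopProg)

namespace LoopProg

/-- The variable that holds the length of a loop. -/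
def lengthVar (double : Bool) : ℕ := if double then 2 else 0

/-- The program for the random access machine; the outermost loops use the variable `d`, those
inside them the variable `d + 1`, and so on. -/
def compile : LoopProg → ℕ → Prog
  | mark e a i j, _ => .ite e (.store a i j (.const 1)) .skip
  | seq p q, d => .seq (p.compile d) (q.compile d)
  | loop w p, d =>
      .seq (.loop (.lt (.var d) (.var (lengthVar w)))
        (.seq (p.compile (d + 1)) (.assign d (.add (.var d) (.const 1)))))
        (.assign d (.const 0))

/-- The arrays after the run of a loop program. -/
def den : LoopProg → ℕ → (ℕ → ℕ) → Arrays → Arrays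
  | mark e a i j, _, env, A =>
      if e.eval ⟨env, A⟩ ≠ 0 then
        (State.setArr ⟨env, A⟩ a (i.eval ⟨env, A⟩) (j.eval ⟨env, A⟩) 1).arr
      else A
  | seq p q, d, env, A => q.den d env (p.den d env A)
  | loop w p, d, env, A =>
      Nat.rec A (fun k B => p.den (d + 1) (Function.update env d k) B) (env (lengthVar w))

/-- A bound on the running time. -/
noncomputable def cost : LoopProg → Polynomial ℕ
  | mark e _ i j => Polynomial.C (e.cost + i.cost + j.cost + 4)
  | seq p q => p.cost + q.cost
  | loop _ p => 2 * Polynomial.X * (p.cost + 8) + 6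

theorem setVar_mk_update (env : ℕ → ℕ) (A : Arrays) (x v w : ℕ) :
    State.setVar ⟨Function.update env x v, A⟩ x w = ⟨Function.update env x w, A⟩ := by
  ext y
  · by_cases h : y = x <;> simp [State.setVar, h]
  · rfl

/-- Counters start at zero and are reset after each loop, so an inner loop can be entered again; `2
< d` protects the variables that hold the loop lengths. -/
theorem exec_compile (p : LoopProg) : ∀ (d : ℕ) (env : ℕ → ℕ) (A : Arrays), 2 < d →
    env 2 = 2 * env 0 → (∀ x, d ≤ x → env x = 0) →
    ∃ t, Exec (p.compile d) ⟨env, A⟩ t ⟨env, p.den d env A⟩ ∧ t ≤ p.cost.eval (env 0) := by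
  induction p with
  | mark e a i j =>
    intro d env A _ _ _
    by_cases h : e.eval ⟨env, A⟩ = 0
    · refine ⟨e.cost + 1 + 1, ?_, ?_⟩
      · have := Exec.ite_false (P := .store a i j (.const 1)) h (Exec.skip ⟨env, A⟩)
        simpa [compile, den, h] using this
      · simp [cost]; omega
    · refine ⟨e.cost + 1 + (i.cost + j.cost + (Expr.const 1).cost + 1), ?_, ?_⟩
      · have := Exec.ite_true (Q := .skip) h (Exec.store ⟨env, A⟩ a i j (.const 1))
        simpa [compile, den, h, State.setArr] using this
      · simp [cost, Expr.cost]; omega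
  | seq p q hp hq =>
    intro d env A hd h2 h0
    obtain ⟨t, ht, ht'⟩ := hp d env A hd h2 h0
    obtain ⟨u, hu, hu'⟩ := hq d env (p.den d env A) hd h2 h0
    exact ⟨t + u, ht.seq hu, by simpa [cost] using Nat.add_le_add ht' hu'⟩
  | loop w p hp =>
    intro d env A hd h2 h0
    set y := lengthVar w with hy
    have hyd : y ≠ d := by unfold lengthVar at hy; split at hy <;> omega
    have hN : env y ≤ 2 * env 0 := by unfold lengthVar at hy; split at hy <;> rw [hy] <;> omega
    set B : ℕ → Arrays := fun k =>
      Nat.rec A (fun k B => p.den (d + 1) (Function.update env d k) B) k with hB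
    -- Here m counts the remaining rounds. Besides its body, a round takes four steps for the test
    -- and four for the increment; the last, failing test takes four. The reset adds two more,
    -- whence the 6 in `cost`.
    have main : ∀ m k, k + m = env y →
        ∃ t, Exec (.loop (.lt (.var d) (.var y))
          (.seq (p.compile (d + 1)) (.assign d (.add (.var d) (.const 1)))))
          ⟨Function.update env d k, B k⟩ t ⟨Function.update env d (env y), B (env y)⟩ ∧
          t ≤ m * (p.cost.eval (env 0) + 8) + 4 := by
      intro m
      induction m with
      | zero =>
        rintro k rfl
        exact ⟨_, Exec.loop_false (by simp [Expr.eval, hyd]), by simp [Expr.cost]⟩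
      | succ m ih =>
        intro k hk
        obtain ⟨t, ht, ht'⟩ := hp (d + 1) (Function.update env d k) (B k) (by omega)
          (by rw [Function.update_of_ne (by omega), Function.update_of_ne (by omega), h2])
          (fun x hx => by rw [Function.update_of_ne (by omega), h0 x (by omega)])
        obtain ⟨u, hu, hu'⟩ := ih (k + 1) (by omega)
        have h1 := Exec.assign ⟨Function.update env d k, B (k + 1)⟩ d (.add (.var d) (.const 1))
        rw [setVar_mk_update] at h1
        simp only [Expr.eval, Function.update_self] at h1
        refine ⟨_, Exec.loop_true ?_ (ht.seq h1) hu, ?_⟩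
        · simp [Expr.eval, hyd]; omega
        · rw [Function.update_of_ne (by omega)] at ht'
          simp only [Expr.cost]
          rw [Nat.succ_mul]
          omega
    obtain ⟨t, ht, ht'⟩ := main (env y) 0 (by omega)
    have h1 := Exec.assign ⟨Function.update env d (env y), B (env y)⟩ d (.const 0)
    rw [setVar_mk_update] at h1
    have hd0 : Function.update env d 0 = env := by
      rw [← h0 d le_rfl]; exact Function.update_eq_self d env
    simp only [Expr.eval, hd0] at h1 ht
    refine ⟨_, ht.seq h1, ?_⟩
    have : env y * (p.cost.eval (env 0) + 8) ≤ 2 * env 0 * (p.cost.eval (env 0) + 8) :=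
      Nat.mul_le_mul_right _ hN
    simp only [cost, Expr.cost, Polynomial.eval_add, Polynomial.eval_mul, Polynomial.eval_ofNat,
      Polynomial.eval_X]
    omega

theorem den_loop_induction (w : Bool) (p : LoopProg) (d : ℕ) (env : ℕ → ℕ) (A : Arrays)
    (I : ℕ → Arrays → Prop) (h0 : I 0 A)
    (hs : ∀ k < env (lengthVar w), ∀ B, I k B →
      I (k + 1) (p.den (d + 1) (Function.update env d k) B)) :
    I (env (lengthVar w)) ((loop w p).den d env A) := by
  have : ∀ m ≤ env (lengthVar w), I m
      (Nat.rec A (fun k B => p.den (d + 1) (Function.update env d k) B) m : Arrays) := by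
    intro m
    induction m with
    | zero => exact fun _ => h0
    | succ m ih => exact fun hm => hs m hm _ (ih (by omega))
  exact this _ le_rfl

end LoopProg

/-! ### Marking entries of an array -/

open Classical in
/-- The arrays after ones have been entered at the positions of the array `a` that satisfy `Q`. -/
noncomputable def Arrays.mark (a : ℕ) (Q : ℕ → ℕ → Prop) (A : Arrays) : Arrays :=
  fun b i j => if b = a ∧ Q i j then 1 else A b i j

namespace Arrays

theorem mark_of_ne {a b : ℕ} (h : b ≠ a) (Q : ℕ → ℕ → Prop) (A : Arrays) : A.mark a Q b = A b := by
  funext i j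
  simp [mark, h]

theorem mark_ne_zero {a : ℕ} {Q : ℕ → ℕ → Prop} {A : Arrays} {i j : ℕ} :
    A.mark a Q a i j ≠ 0 ↔ A a i j ≠ 0 ∨ Q i j := by
  by_cases h : Q i j <;> simp [mark, h]

theorem mark_mark (a : ℕ) (Q R : ℕ → ℕ → Prop) (A : Arrays) :
    (A.mark a Q).mark a R = A.mark a fun i j => Q i j ∨ R i j := by
  funext b i j
  by_cases hb : b = a <;> by_cases hQ : Q i j <;> by_cases hR : R i j <;> simp [mark, hb, hQ, hR]

theorem mark_false (a : ℕ) (A : Arrays) : A.mark a (fun _ _ => False) = A := by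
  funext b i j
  simp [mark]

end Arrays

/-- From arrays that satisfy `S`, the loop program marks the positions of the array `a` that
satisfy `Q`, and `S` persists. -/
def Marks (S : Arrays → Prop) (p : LoopProg) (d : ℕ) (env : ℕ → ℕ) (a : ℕ)
    (Q : ℕ → ℕ → Prop) : Prop :=
  ∀ A, S A → p.den d env A = A.mark a Q ∧ S (A.mark a Q)

namespace Marks

variable {S : Arrays → Prop} {p q : LoopProg} {d : ℕ} {env : ℕ → ℕ} {a : ℕ}

/-- The invariant `S` makes condition and address independent of earlier marks, so that a nest of
loops amounts to a single union of marks. The array written to may still be read where `S` controls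
its entries. -/
theorem mark {e i j : Expr} {c : Prop} {u v : ℕ} (he : ∀ A, S A → (e.Holds ⟨env, A⟩ ↔ c))
    (hi : ∀ A, S A → i.eval ⟨env, A⟩ = u) (hj : ∀ A, S A → j.eval ⟨env, A⟩ = v)
    (hS : ∀ A, S A → c → S (A.mark a fun k l => k = u ∧ l = v)) :
    Marks S (.mark e a i j) d env a (fun k l => c ∧ k = u ∧ l = v) := by
  intro A hA
  by_cases hc : c
  · have := (he A hA).2 hc
    simp only [hc, true_and]
    refine ⟨?_, hS A hA hc⟩
    rw [LoopProg.den, if_pos (show e.eval ⟨env, A⟩ ≠ 0 from this), hi A hA, hj A hA]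
    funext b k l
    simp [State.setArr, Arrays.mark]
  · have : ¬ e.eval ⟨env, A⟩ ≠ 0 := fun h => hc ((he A hA).1 h)
    simp only [hc, false_and]
    rw [LoopProg.den, if_neg this, Arrays.mark_false]
    exact ⟨rfl, hA⟩

theorem seq {Q R : ℕ → ℕ → Prop} (hp : Marks S p d env a Q) (hq : Marks S q d env a R) :
    Marks S (.seq p q) d env a (fun i j => Q i j ∨ R i j) := by
  intro A hA
  obtain ⟨h1, h2⟩ := hp A hA
  obtain ⟨h3, h4⟩ := hq _ h2
  rw [LoopProg.den, h1, h3, Arrays.mark_mark]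
  rw [Arrays.mark_mark] at h4
  exact ⟨rfl, h4⟩

theorem loop {w : Bool} {Q : ℕ → ℕ → ℕ → Prop}
    (h : ∀ k < env (LoopProg.lengthVar w), Marks S p (d + 1) (Function.update env d k) a (Q k)) :
    Marks S (.loop w p) d env a (fun i j => ∃ k < env (LoopProg.lengthVar w), Q k i j) := by
  intro A hA
  refine LoopProg.den_loop_induction w p d env A
    (fun m B => B = A.mark a (fun i j => ∃ k < m, Q k i j) ∧
      S (A.mark a (fun i j => ∃ k < m, Q k i j))) ?_ ?_
  · simpa [Arrays.mark_false] using hA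
  · rintro k hk B ⟨rfl, hS⟩
    obtain ⟨h1, h2⟩ := h k hk _ hS
    rw [h1]
    rw [Arrays.mark_mark] at h2 ⊢
    have : (fun i j => (∃ l < k, Q l i j) ∨ Q k i j) = fun i j => ∃ l < k + 1, Q l i j := by
      funext i j
      simp only [Nat.lt_succ_iff_lt_or_eq, eq_iff_iff]
      constructor
      · rintro (⟨l, hl, h⟩ | h)
        exacts [⟨l, .inl hl, h⟩, ⟨k, .inr rfl, h⟩]
      · rintro ⟨l, hl | rfl, h⟩
        exacts [.inl ⟨l, hl, h⟩, .inr h]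
    rw [this] at h2 ⊢
    exact ⟨rfl, h2⟩

end Marks

namespace LoopProg

/-- The program writes to the array `a` and does not read it. -/
def WritesOnly (a : ℕ) : LoopProg → Prop
  | mark e b i j => b = a ∧ e.Avoids a ∧ i.Avoids a ∧ j.Avoids a
  | seq p q => p.WritesOnly a ∧ q.WritesOnly a
  | loop _ p => p.WritesOnly a

/-- The positions that the program marks if it does not read the array it writes to. -/
def marked (A : Arrays) : LoopProg → ℕ → (ℕ → ℕ) → ℕ → ℕ → Prop
  | mark e _ i j, _, env, k, l =>
      e.Holds ⟨env, A⟩ ∧ k = i.eval ⟨env, A⟩ ∧ l = j.eval ⟨env, A⟩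
  | seq p q, d, env, k, l => p.marked A d env k l ∨ q.marked A d env k l
  | loop w p, d, env, k, l =>
      ∃ m < env (lengthVar w), p.marked A (d + 1) (Function.update env d m) k l

theorem WritesOnly.marks {a : ℕ} {A : Arrays} : ∀ {p : LoopProg}, p.WritesOnly a →
    ∀ (d : ℕ) (env : ℕ → ℕ),
      Marks (fun B => ∀ b, b ≠ a → B b = A b) p d env a (p.marked A d env)
  | mark e _ i j, ⟨rfl, he, hi, hj⟩, d, env => by
      refine Marks.mark (fun B hB => ?_) (fun B hB => hi.eval_congr hB)
        (fun B hB => hj.eval_congr hB)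
        (fun B hB _ b hb => by rw [Arrays.mark_of_ne hb, hB b hb])
      rw [Expr.Holds, Expr.Holds, he.eval_congr hB]
  | seq _ _, ⟨hp, hq⟩, d, env => (hp.marks d env).seq (hq.marks d env)
  | loop _ p, hp, d, env =>
      Marks.loop fun k _ => WritesOnly.marks (p := p) hp (d + 1) (Function.update env d k)

theorem WritesOnly.den_eq {a : ℕ} {p : LoopProg} (h : p.WritesOnly a) (d : ℕ) (env : ℕ → ℕ)
    (A : Arrays) : p.den d env A = A.mark a (p.marked A d env) :=
  (h.marks d env A fun _ _ => rfl).1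

/-- The program does not write to the array `b`. -/
def Preserves (b : ℕ) : LoopProg → Prop
  | mark _ a _ _ => b ≠ a
  | seq p q => p.Preserves b ∧ q.Preserves b
  | loop _ p => p.Preserves b

theorem Preserves.den_eq {b : ℕ} : ∀ {p : LoopProg}, p.Preserves b →
    ∀ (d : ℕ) (env : ℕ → ℕ) (A : Arrays), p.den d env A b = A b
  | mark e a i j, hb, d, env, A => by
      have hb : b ≠ a := hb
      rw [den]
      split
      · funext k l
        simp [State.setArr, hb]
      · rfl
  | seq _ _, ⟨hp, hq⟩, d, env, A => (hq.den_eq d env _).trans (hp.den_eq d env A)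
  | loop w p, hp, d, env, A =>
      den_loop_induction w p d env A (fun _ B => B b = A b) rfl fun k _ B hB =>
        (Preserves.den_eq (p := p) hp (d + 1) (Function.update env d k) B).trans hB

end LoopProg

end RAM

/-! ### Reduction to clauses with at most two literals -/

namespace Monopolar

variable {V : Type*} {G : SimpleGraph V} {C' I' : Set V}

/-- Without induced paths on three vertices, adjacency to the end of a walk propagates back to its
start. -/
theorem isClusterGraph_iff {H : SimpleGraph V} :
    IsClusterGraph H ↔ ∀ a b c, H.Adj a b → H.Adj b c → a ≠ c → H.Adj a c := by
  constructor
  · intro h a b c hab hbc hac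
    refine h (H.connectedComponentMk a) rfl ?_ hac
    exact SimpleGraph.ConnectedComponent.sound (hab.reachable.trans hbc.reachable).symm
  · intro h K a ha c hc hac
    have : H.Reachable a c := SimpleGraph.ConnectedComponent.exact (ha.trans hc.symm)
    obtain ⟨w⟩ := this
    clear ha hc
    induction w with
    | nil => exact absurd rfl hac
    | @cons u v w huv _ ih =>
      by_cases hvw : v = w
      · exact hvw ▸ huv
      · exact h _ _ _ huv (ih hvw) hac

theorem isClusterGraph_induce_iff {C : Set V} :
    IsClusterGraph (G.induce C) ↔ ∀ a ∈ C, ∀ b ∈ C, ∀ c ∈ C, G.Adj a b → G.Adj b c → a ≠ c →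
      G.Adj a c := by
  simp [isClusterGraph_iff]

/-- The vertex `b` dominates an induced path on three vertices. -/
def DominatesPath (G : SimpleGraph V) (b : V) : Prop :=
  ∃ u v w, G.Adj b u ∧ G.Adj b v ∧ G.Adj b w ∧ G.Adj u v ∧ G.Adj v w ∧ ¬ G.Adj u w ∧ u ≠ w

/-- A vertex that must lie in the cluster part. -/
def Forced (G : SimpleGraph V) (C' : Set V) (b : V) : Prop :=
  b ∈ C' ∨ DominatesPath G b

/-- A vertex of `C'`, a neighbour of such a vertex, or a vertex of a triangle. -/
def NearModulator (G : SimpleGraph V) (C' : Set V) (b : V) : Prop :=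
  b ∈ C' ∨ (∃ x, x ∈ C' ∧ G.Adj b x) ∨ ∃ u v, G.Adj b u ∧ G.Adj b v ∧ G.Adj u v

/-- The vertices `u`, `v` form an induced path on three vertices with a vertex of `C'`, which is
the middle vertex or adjacent to `u`. -/
def PathConflict (G : SimpleGraph V) (C' : Set V) (u v : V) : Prop :=
  ∃ x, x ∈ C' ∧ G.Adj x u ∧
    ((G.Adj x v ∧ ¬ G.Adj u v ∧ u ≠ v) ∨ (G.Adj u v ∧ ¬ G.Adj x v ∧ x ≠ v))

/-- `b` is the vertex of degree three and `c` the vertex of degree one of an induced paw. -/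
def PawConflict (G : SimpleGraph V) (b c : V) : Prop :=
  ∃ u v, G.Adj b c ∧ G.Adj b u ∧ G.Adj b v ∧ G.Adj u v ∧ ¬ G.Adj c u ∧ ¬ G.Adj c v

/-- `u` and `v` are nonadjacent neighbours of a forced vertex that dominates a path. -/
def ForcedConflict (G : SimpleGraph V) (u v : V) : Prop :=
  ∃ b, DominatesPath G b ∧ G.Adj b u ∧ G.Adj b v ∧ ¬ G.Adj u v ∧ u ≠ v

/-- `a` is a neighbour of a vertex `b` that has degree at least three, is in no triangle, and has
no neighbour in `C'`. -/
def ClawConflict (G : SimpleGraph V) (C' : Set V) (b a : V) : Prop :=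
  ∃ c d, ¬ NearModulator G C' b ∧ G.Adj b a ∧ G.Adj b c ∧ G.Adj b d ∧ a ≠ c ∧ a ≠ d ∧ c ≠ d

/-- Pairs of vertices that need not both be in the cluster part. -/
def Conflict (G : SimpleGraph V) (C' : Set V) (u v : V) : Prop :=
  PathConflict G C' u v ∨ PawConflict G u v ∨ ForcedConflict G u v ∨ ClawConflict G C' u v

/-- The independent part `J` satisfies all clauses with at most two literals. -/
structure SatisfiesClauses (G : SimpleGraph V) (C' I' J : Set V) : Prop where
  indep : ∀ u v, G.Adj u v → ¬ (u ∈ J ∧ v ∈ J)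
  forced : ∀ u, Forced G C' u → u ∉ J
  subset : ∀ u ∈ I', u ∈ J
  conflict : ∀ u v, Conflict G C' u v → u ∈ J ∨ v ∈ J

/-- Clauses saying that one of two vertices is in the independent part survive enlargement. They
exclude an induced path a, b, c in the complement by cases on its middle vertex b; maximality is
used only when b is far from `C'` and in no triangle. -/
theorem SatisfiesClauses.isMonopolarExtension {J K : Set V} (h : SatisfiesClauses G C' I' J)
    (hJK : J ⊆ K) (hK : ∀ u v, G.Adj u v → ¬ (u ∈ K ∧ v ∈ K)) (hC : ∀ u ∈ C', u ∉ K)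
    (hmax : ∀ v, v ∉ C' → v ∉ K → ∃ w ∈ K, G.Adj v w) :
    IsMonopolarExtension G C' I' Kᶜ K := by
  refine ⟨⟨disjoint_compl_left, Set.compl_union_self K, ?_, ?_⟩, hC, fun u hu => hJK (h.subset u hu)⟩
  · rw [isClusterGraph_induce_iff]
    intro a ha b hb c hc hab hbc hne
    by_contra hac
    have key : ∀ {u v}, u ∈ Kᶜ → v ∈ Kᶜ → ¬ Conflict G C' u v := fun hu hv huv =>
      (h.conflict _ _ huv).elim (fun h => hu (hJK h)) (fun h => hv (hJK h))
    have hba := hab.symm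
    have hcb := hbc.symm
    have hca : ¬ G.Adj c a := fun h => hac h.symm
    by_cases hbC : b ∈ C'
    · exact key ha hc (.inl ⟨b, hbC, hba, .inl ⟨hbc, hac, hne⟩⟩)
    by_cases hD : DominatesPath G b
    · exact key ha hc (.inr (.inr (.inl ⟨b, hD, hba, hbc, hac, hne⟩)))
    -- Either x is an end of the path, or x forms an induced path with two of a, b, c.
    by_cases hx : ∃ x, x ∈ C' ∧ G.Adj b x
    · obtain ⟨x, hxC, hbx⟩ := hx
      by_cases hxa : x = a
      · exact key hb hc (.inl ⟨a, hxa ▸ hxC, hab, .inr ⟨hbc, hac, hne⟩⟩)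
      by_cases hxc : x = c
      · exact key hb ha (.inl ⟨c, hxc ▸ hxC, hcb, .inr ⟨hba, hca, hne.symm⟩⟩)
      by_cases h1 : G.Adj x a
      · by_cases h2 : G.Adj x c
        · exact key ha hc (.inl ⟨x, hxC, h1, .inl ⟨h2, hac, hne⟩⟩)
        · exact key hb hc (.inl ⟨x, hxC, hbx.symm, .inr ⟨hbc, h2, hxc⟩⟩)
      · exact key hb ha (.inl ⟨x, hxC, hbx.symm, .inr ⟨hba, h1, hxa⟩⟩)
    by_cases ht : ∃ u v, G.Adj b u ∧ G.Adj b v ∧ G.Adj u v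
    -- A common neighbour a' of a and b would make b dominate the path a, a', c, or make c the
    -- pendant vertex of a paw. Without one, a itself is the pendant vertex of a paw on any triangle
    -- at b.
    · have hno : ∀ a', G.Adj b a' → ¬ G.Adj a a' := by
        intro a' hba' haa'
        by_cases hca' : G.Adj c a'
        · exact hD ⟨a, a', c, hba, hba', hbc, haa', hca'.symm, hac, hne⟩
        · exact key hb hc (.inr (.inl ⟨a, a', hbc, hba, hba', haa', hca, hca'⟩))
      obtain ⟨u, v, hbu, hbv, huv⟩ := ht
      exact key hb ha (.inr (.inl ⟨u, v, hba, hbu, hbv, huv, hno u hbu, hno v hbv⟩))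
    -- The third neighbour of b: it differs from a and c, which are outside K.
    obtain ⟨w, hwK, hbw⟩ := hmax b hbC hb
    refine key hb ha (.inr (.inr (.inr ⟨c, w, ?_, hba, hbc, hbw, hne, ?_, ?_⟩)))
    · rintro (h | h | h)
      exacts [hbC h, hx h, ht h]
    · rintro rfl; exact ha hwK
    · rintro rfl; exact hc hwK
  · intro u hu v hv _ huv
    exact hK u v huv ⟨hu, hv⟩

/-! ### Necessity of the clauses when the rest is chair-free -/

theorem chair_isIndContained {b c d a e : V} (hbc : G.Adj b c) (hbd : G.Adj b d) (hba : G.Adj b a)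
    (hae : G.Adj a e) (hcd : ¬ G.Adj c d) (hca : ¬ G.Adj c a) (hda : ¬ G.Adj d a)
    (hbe : ¬ G.Adj b e) (hce : ¬ G.Adj c e) (hde : ¬ G.Adj d e)
    (ncd : c ≠ d) (nca : c ≠ a) (nda : d ≠ a) : chair.IsIndContained G := by
  have nbe : b ≠ e := by rintro rfl; exact hce hbc.symm
  have nce : c ≠ e := by rintro rfl; exact hbe hbc
  have nde : d ≠ e := by rintro rfl; exact hbe hbd
  refine ⟨⟨⟨![c, b, d, a, e], ?_⟩, ?_⟩⟩
  · intro i j hij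
    have := hbc.ne; have := hbd.ne; have := hba.ne; have := hae.ne
    fin_cases i <;> fin_cases j <;> simp_all [eq_comm]
  · intro i j
    change G.Adj (![c, b, d, a, e] i) (![c, b, d, a, e] j) ↔ chair.Adj i j
    fin_cases i <;> fin_cases j <;>
      simp_all [chair, SimpleGraph.adj_comm]

/-- All clauses but `ClawConflict` hold in every extension. For the latter the independent part is
taken maximal, so that each cluster vertex outside `C'` has a neighbour in it. -/
theorem MonopolarExtendable.exists_satisfiesClauses [Finite V] (hmod : IsChairFreeModulator G C')
    (h : MonopolarExtendable G C' I') : ∃ J, SatisfiesClauses G C' I' J := by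
  obtain ⟨C, I, hCI⟩ := h
  have hIC : Cᶜ = I := (IsCompl.of_eq (Set.disjoint_iff_inter_eq_empty.1 hCI.1.1)
    hCI.1.2.1).compl_eq
  obtain ⟨J, -, hJ⟩ := (Set.toFinite {J : Set V | IsMonopolarExtension G C' I' Jᶜ J}).exists_le_maximal
    (a := I) (by subst hIC; simpa using hCI)
  obtain ⟨⟨-, -, hP, hI⟩, hCJ, hIJ⟩ := hJ.prop
  rw [isClusterGraph_induce_iff] at hP
  have hind : ∀ {u v}, G.Adj u v → u ∈ J → v ∉ J := fun huv hu hv => hI hu hv huv.ne huv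
  have hmax : ∀ v, v ∉ C' → v ∉ J → ∃ w ∈ J, G.Adj v w := by
    intro v hvC hvJ
    by_contra! hno
    refine hvJ (hJ.le_of_ge (y := insert v J) ?_ (Set.subset_insert v J) (Set.mem_insert v J))
    refine ⟨⟨disjoint_compl_left, Set.compl_union_self _, ?_, ?_⟩, ?_,
      hIJ.trans (Set.subset_insert v J)⟩
    · rw [isClusterGraph_induce_iff]
      intro a ha b hb c hc
      exact hP a (fun h => ha (.inr h)) b (fun h => hb (.inr h)) c (fun h => hc (.inr h))
    · rintro x (rfl | hx) y (rfl | hy) hne hxy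
      exacts [hne rfl, hno y hy hxy, hno x hx hxy.symm, hind hxy hx hy]
    · rintro x hx (rfl | hxJ)
      exacts [hvC hx, hCJ hx hxJ]
  have hdom : ∀ b, DominatesPath G b → b ∉ J := by
    rintro b ⟨u, v, w, hbu, hbv, hbw, huv, hvw, huw, hne⟩ hb
    exact huw (hP u (hind hbu hb) v (hind hbv hb) w (hind hbw hb) huv hvw hne)
  refine ⟨J, fun u v huv h => hind huv h.1 h.2, ?_, hIJ, ?_⟩
  · rintro u (hu | hu)
    exacts [hCJ hu, hdom u hu]
  · intro u v huv
    by_contra! hJ'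
    obtain ⟨hu, hv⟩ := hJ'
    rcases huv with ⟨x, hx, hxu, ⟨hxv, huv, hne⟩ | ⟨huv, hxv, hne⟩⟩ |
      ⟨p, q, huv, hup, huq, hpq, hvp, hvq⟩ | ⟨b, hb, hbu, hbv, huv, hne⟩ |
      ⟨c, d, hfar, huv, huc, hud, hvc, hvd, hcd⟩
    · exact huv (hP u hu x (hCJ hx) v hv hxu.symm hxv hne)
    · exact hxv (hP x (hCJ hx) u hu v hv hxu huv hne)
    · have nvp : v ≠ p := by rintro rfl; exact hvq hpq
      have nvq : v ≠ q := by rintro rfl; exact hvp hpq.symm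
      -- The adjacent vertices p and q are not both independent; one in the cluster part would
      -- complete an induced path with u and v.
      by_cases hp : p ∈ J
      · exact hvq (hP v hv u hu q (hind hpq hp) huv.symm huq nvq)
      · exact hvp (hP v hv u hu p hp huv.symm hup nvp)
    · exact huv (hP u hu b (hdom b hb) v hv hbu.symm hbv hne)
    · simp only [NearModulator, not_or, not_exists, not_and] at hfar
      obtain ⟨huC, hnC, htri⟩ := hfar
      have hnotC : ∀ {x}, G.Adj u x → x ∉ C' := fun h hx => hnC _ hx h
      obtain ⟨e, he, hve⟩ := hmax v (hnotC huv) hv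
      -- A neighbour x of e lies in the cluster part, so the path v, u, x would close to a triangle
      -- at u. Hence c, d, v and e form a chair with centre u.
      have key : ∀ x, G.Adj u x → v ≠ x → ¬ G.Adj x e := by
        intro x hux hvx hxe
        exact htri v x huv hux
          (hP v hv u hu x (fun hx => hind hxe hx he) huv.symm hux hvx)
      have hue : ¬ G.Adj u e := fun h => htri v e huv h hve
      refine hmod ?_
      exact chair_isIndContained (G := G.induce C'ᶜ) (b := ⟨u, huC⟩) (c := ⟨c, hnotC huc⟩)
        (d := ⟨d, hnotC hud⟩) (a := ⟨v, hnotC huv⟩) (e := ⟨e, fun h => hCJ h he⟩)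
        huc hud huv hve (htri c d huc hud) (htri c v huc huv) (htri d v hud huv) hue
        (key c huc hvc) (key d hud hvd) (by simpa using hcd) (by simpa using hvc.symm)
        (by simpa using hvd.symm)

end Monopolar

/-! ### Satisfiability of clauses with two literals -/

namespace TwoSat

/-- The negation of a literal: `u < n` stands for a variable, and `u + n` for its negation. -/
def neg (n l : ℕ) : ℕ := if l < n then l + n else l - n

variable {n : ℕ}

theorem neg_of_lt {u : ℕ} (h : u < n) : neg n u = u + n := by simp [neg, h]

theorem neg_add (u : ℕ) : neg n (u + n) = u := by simp [neg]

theorem neg_lt {l : ℕ} (h : l < 2 * n) : neg n l < 2 * n := by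
  unfold neg; split <;> omega

/-- The implications between literals, for the clauses `u ∨ v` where `pos u v` and the clauses
`¬ u ∨ ¬ v` where `ng u v`. -/
def Implication (n : ℕ) (pos ng : ℕ → ℕ → Prop) (i j : ℕ) : Prop :=
  ((∃ l < 2 * n, i = l ∧ j = l) ∨ ∃ u < n, ∃ v < n, pos u v ∧ i = u + n ∧ j = v) ∨
    ∃ u < n, ∃ v < n, ng u v ∧ i = u ∧ j = v + n

/-- A preorder on the literals that is invariant under contraposition. -/
structure IsImplicationOrder (n : ℕ) (R : ℕ → ℕ → Prop) : Prop where
  lt : ∀ i j, R i j → i < 2 * n ∧ j < 2 * n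
  refl : ∀ i < 2 * n, R i i
  trans : ∀ i j k, R i j → R j k → R i k
  skew : ∀ i j, R i j → R (neg n j) (neg n i)

/-- No variable is equivalent to its negation. -/
def Consistent (n : ℕ) (R : ℕ → ℕ → Prop) : Prop :=
  ∀ u < n, ¬ (R u (u + n) ∧ R (u + n) u)

/-- Contraposition turns the implication of a clause into that of the same clause with its literals
exchanged, hence the symmetry hypotheses. -/
theorem isImplicationOrder_transGen {pos ng : ℕ → ℕ → Prop}
    (hpos : ∀ u < n, ∀ v < n, pos u v → pos v u) (hng : ∀ u < n, ∀ v < n, ng u v → ng v u) :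
    IsImplicationOrder n (Relation.TransGen (Implication n pos ng)) := by
  have hlt : ∀ i j, Implication n pos ng i j → i < 2 * n ∧ j < 2 * n := by
    rintro i j ((⟨l, hl, rfl, rfl⟩ | ⟨u, hu, v, hv, -, rfl, rfl⟩) | ⟨u, hu, v, hv, -, rfl, rfl⟩) <;>
      omega
  have hskew : ∀ i j, Implication n pos ng i j → Implication n pos ng (neg n j) (neg n i) := by
    rintro i j ((⟨l, hl, rfl, rfl⟩ | ⟨u, hu, v, hv, h, rfl, rfl⟩) | ⟨u, hu, v, hv, h, rfl, rfl⟩)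
    · exact .inl (.inl ⟨_, neg_lt hl, rfl, rfl⟩)
    · exact .inl (.inr ⟨_, hv, u, hu, hpos u hu _ hv h, neg_of_lt hv, neg_add u⟩)
    · exact .inr ⟨v, hv, _, hu, hng _ hu v hv h, neg_add v, neg_of_lt hu⟩
  refine ⟨fun i j h => ?_, fun i hi => .single (.inl (.inl ⟨i, hi, rfl, rfl⟩)),
    fun i j k => .trans, fun i j h => ?_⟩
  · induction h with
    | single h => exact hlt _ _ h
    | tail _ h ih => exact ⟨ih.1, (hlt _ _ h).2⟩
  · induction h with
    | single h => exact .single (hskew _ _ h)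
    | tail _ h ih => exact .head (hskew _ _ h) ih

/-- Read the literal u as "u is outside J" and u + n as "u is in J". Truth passes along
implications, so no literal can be equivalent to its negation. -/
theorem consistent_transGen_of_model {pos ng : ℕ → ℕ → Prop} {J : ℕ → Prop}
    (hpos : ∀ u < n, ∀ v < n, pos u v → ¬ (J u ∧ J v))
    (hng : ∀ u < n, ∀ v < n, ng u v → J u ∨ J v) :
    Consistent n (Relation.TransGen (Implication n pos ng)) := by
  set val : ℕ → Prop := fun l => if l < n then ¬ J l else J (l - n) with hval
  have val_lt : ∀ u < n, (val u ↔ ¬ J u) := fun u hu => by simp [hval, hu]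
  have val_add : ∀ u, (val (u + n) ↔ J u) := fun u => by simp [hval]
  have key : ∀ i j, Relation.TransGen (Implication n pos ng) i j → val i → val j := by
    intro i j h
    have step : ∀ i j, Implication n pos ng i j → val i → val j := by
      rintro i j ((⟨l, hl, rfl, rfl⟩ | ⟨u, hu, v, hv, h, rfl, rfl⟩) | ⟨u, hu, v, hv, h, rfl, rfl⟩)
      · exact id
      · rw [val_lt _ hv, val_add]
        exact fun h1 h2 => hpos u hu _ hv h ⟨h1, h2⟩
      · rw [val_lt _ hu, val_add]
        exact fun h1 => (hng _ hu v hv h).resolve_left h1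
    induction h with
    | single h => exact step _ _ h
    | tail _ h ih => exact fun hi => step _ _ h (ih hi)
  rintro u hu ⟨h1, h2⟩
  have h1 := key _ _ h1
  have h2 := key _ _ h2
  rw [val_lt u hu, val_add] at h1 h2
  by_cases h : J u
  exacts [h2 h h, h (h1 h)]

/-- The preorder after the literal `v` has been made true, unless it is known to be false. -/
def decideLiteral (n v : ℕ) (R : ℕ → ℕ → Prop) (i j : ℕ) : Prop :=
  R i j ∨ (¬ R v (v + n) ∧ R i (v + n) ∧ R v j)

theorem decideLiteral_total {R : ℕ → ℕ → Prop} (h : IsImplicationOrder n R) {v : ℕ} (hv : v < n) :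
    decideLiteral n v R v (v + n) ∨ decideLiteral n v R (v + n) v := by
  by_cases hR : R v (v + n)
  · exact .inl (.inl hR)
  · exact .inr (.inr ⟨hR, h.refl _ (by omega), h.refl _ (by omega)⟩)

/-- Deciding v adds the implication from v + n to v, which is its own contrapositive. Transitivity
needs no further closure: using the new implication twice would require v to imply v + n, the
excluded case. -/
theorem IsImplicationOrder.decideLiteral {R : ℕ → ℕ → Prop} (h : IsImplicationOrder n R) {v : ℕ}
    (hv : v < n) : IsImplicationOrder n (decideLiteral n v R) := by
  refine ⟨?_, fun i hi => .inl (h.refl i hi), ?_, ?_⟩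
  · rintro i j (hR | ⟨-, h1, h2⟩)
    exacts [h.lt i j hR, ⟨(h.lt _ _ h1).1, (h.lt _ _ h2).2⟩]
  · rintro i j k (h1 | ⟨h0, h1, h2⟩) (h3 | ⟨h4, h5, h6⟩)
    · exact .inl (h.trans _ _ _ h1 h3)
    · exact .inr ⟨h4, h.trans _ _ _ h1 h5, h6⟩
    · exact .inr ⟨h0, h1, h.trans _ _ _ h2 h3⟩
    · exact absurd (h.trans _ _ _ h2 h5) h0
  · rintro i j (h1 | ⟨h0, h1, h2⟩)
    · exact .inl (h.skew _ _ h1)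
    · have h1 := h.skew _ _ h1
      have h2 := h.skew _ _ h2
      rw [neg_add] at h1
      rw [neg_of_lt hv] at h2
      exact .inr ⟨h0, h2, h1⟩

/-- A new equivalence of w with its negation would already make v imply v + n in the old preorder.
-/
theorem Consistent.decideLiteral {R : ℕ → ℕ → Prop} (h : IsImplicationOrder n R)
    (hc : Consistent n R) (v : ℕ) : Consistent n (decideLiteral n v R) := by
  rintro w hw ⟨h1 | ⟨h0, h1, h2⟩, h3 | ⟨h4, h5, h6⟩⟩
  · exact hc w hw ⟨h1, h3⟩
  · exact h4 (h.trans _ _ _ h6 (h.trans _ _ _ h1 h5))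
  · exact h0 (h.trans _ _ _ h2 (h.trans _ _ _ h3 h1))
  · exact h0 (h.trans _ _ _ h6 h1)

/-- In a consistent preorder that decides each variable, the false variables form a model. -/
theorem IsImplicationOrder.model {R : ℕ → ℕ → Prop} (h : IsImplicationOrder n R)
    (hc : Consistent n R) (ht : ∀ u < n, R u (u + n) ∨ R (u + n) u) {pos ng : ℕ → ℕ → Prop}
    (hR : ∀ i j, Implication n pos ng i j → R i j) :
    (∀ u < n, ∀ v < n, pos u v → ¬ (R u (u + n) ∧ R v (v + n))) ∧
      ∀ u < n, ∀ v < n, ng u v → R u (u + n) ∨ R v (v + n) := by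
  refine ⟨fun u hu v hv huv hJ => ?_, fun u hu v hv huv => ?_⟩
  -- The chain is u + n ≤ v ≤ v + n ≤ u, against u ≤ u + n.
  · have h1 := hR (u + n) v (.inl (.inr ⟨u, hu, v, hv, huv, rfl, rfl⟩))
    have h2 := h.skew _ _ h1
    rw [neg_add, neg_of_lt hv] at h2
    exact hc u hu ⟨hJ.1, h.trans _ _ _ h1 (h.trans _ _ _ hJ.2 h2)⟩
  · have h1 := hR u (v + n) (.inr ⟨u, hu, v, hv, huv, rfl, rfl⟩)
    have h2 := h.skew _ _ h1
    rw [neg_add, neg_of_lt hu] at h2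
    -- The chain is v ≤ u + n ≤ u ≤ v + n.
    refine (ht u hu).imp_right fun h3 => ?_
    exact h.trans _ _ _ h2 (h.trans _ _ _ h3 h1)

end TwoSat

namespace Monopolar

open RAM

/-! ### The program -/

namespace Program

/-- The variable of the `k`-th of several nested loops. -/
abbrev x (k : ℕ) : Expr := .var (k + 10)

/-- The entry `u` of the vector stored in column `0` of the array `a`. -/
abbrev vec (a : ℕ) (u : Expr) : Expr := .load a u (.const 0)

/-- The adjacency of two vertices. -/
abbrev adj (u v : Expr) : Expr := .load 0 u v

/-- The negative literal of the variable `u`. -/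
abbrev negLit (u : Expr) : Expr := .add u (.var 0)

/-- Conjunction of a list. -/
abbrev all : List Expr → Expr
  | [] => .const 1
  | [e] => e
  | e :: l => e.and (all l)

/-- Computes the vertices in or next to `C'` or in a triangle in the array `5`. -/
def near : LoopProg :=
  .loop false (.seq (.mark (vec 1 (x 0)) 5 (x 0) (.const 0)) (.seq
    (.loop false (.mark (all [vec 1 (x 1), adj (x 0) (x 1)]) 5 (x 0) (.const 0)))
    (.loop false (.loop false
      (.mark (all [adj (x 0) (x 1), adj (x 0) (x 2), adj (x 1) (x 2)]) 5 (x 0) (.const 0))))))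

/-- Computes the vertices that dominate a path in the array `6`. -/
def dominating : LoopProg :=
  .loop false (.loop false (.loop false (.loop false (.mark
    (all [adj (x 0) (x 1), adj (x 0) (x 2), adj (x 0) (x 3), adj (x 1) (x 2), adj (x 2) (x 3),
      (adj (x 1) (x 3)).not, (Expr.eq (x 1) (x 3)).not]) 6 (x 0) (.const 0)))))

/-- Computes the conflicting pairs in the array `9`. -/
def conflict : LoopProg :=
  .loop false (.loop false (.seq
    (.loop false (.mark (all [vec 1 (x 2), adj (x 2) (x 0),
      (all [adj (x 2) (x 1), (adj (x 0) (x 1)).not, (Expr.eq (x 0) (x 1)).not]).or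
      (all [adj (x 0) (x 1), (adj (x 2) (x 1)).not, (Expr.eq (x 2) (x 1)).not])]) 9 (x 0) (x 1)))
    (.seq
    (.loop false (.loop false (.mark (all [adj (x 0) (x 1), adj (x 0) (x 2), adj (x 0) (x 3),
      adj (x 2) (x 3), (adj (x 1) (x 2)).not, (adj (x 1) (x 3)).not]) 9 (x 0) (x 1))))
    (.seq
    (.loop false (.mark (all [vec 6 (x 2), adj (x 2) (x 0), adj (x 2) (x 1),
      (adj (x 0) (x 1)).not, (Expr.eq (x 0) (x 1)).not]) 9 (x 0) (x 1)))
    (.loop false (.loop false (.mark (all [(vec 5 (x 0)).not, adj (x 0) (x 1), adj (x 0) (x 2),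
      adj (x 0) (x 3), (Expr.eq (x 1) (x 2)).not, (Expr.eq (x 1) (x 3)).not,
      (Expr.eq (x 2) (x 3)).not]) 9 (x 0) (x 1))))))))

/-- Computes the implications between literals in the array `4`. -/
def implication : LoopProg :=
  .seq (.seq
    (.loop true (.mark (.const 1) 4 (x 0) (x 0)))
    (.loop false (.loop false (.mark ((adj (x 0) (x 1)).or
      (all [Expr.eq (x 0) (x 1), (vec 1 (x 0)).or (vec 6 (x 0))])) 4 (negLit (x 0)) (x 1)))))
    (.loop false (.loop false (.mark (((Expr.load 9 (x 0) (x 1)).or (.load 9 (x 1) (x 0))).or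
      (all [Expr.eq (x 0) (x 1), vec 2 (x 0)])) 4 (x 0) (negLit (x 1)))))

/-- Replaces the relation in the array `4` by its transitive closure. -/
def closure : LoopProg :=
  .loop true (.loop true (.loop true
    (.mark (all [.load 4 (x 1) (x 0), .load 4 (x 0) (x 2)]) 4 (x 1) (x 2))))

/-- Tests whether a variable is equivalent to its negation. -/
def test : LoopProg :=
  .loop false (.mark (all [.load 4 (x 0) (negLit (x 0)), .load 4 (negLit (x 0)) (x 0)])
    7 (.const 0) (.const 0))

/-- Decides the variables one after the other. -/
def decideAll : LoopProg :=
  .loop false (.loop true (.loop true (.mark (all [(Expr.load 4 (x 0) (negLit (x 0))).not,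
    .load 4 (x 1) (negLit (x 0)), .load 4 (x 0) (x 2)]) 4 (x 1) (x 2))))

/-- Computes the vertices whose variable is false in the array `10`. -/
def pick : LoopProg :=
  .loop false (.mark (.load 4 (x 0) (negLit (x 0))) 10 (x 0) (.const 0))

/-- Tests whether a vertex has a neighbour in the independent set in the array `10`. -/
def scan : LoopProg :=
  .loop false (.mark (all [adj (x 0) (x 1), vec 10 (x 1)]) 8 (x 0) (.const 0))

/-- Adds a vertex to the independent set in the array `10` if that is possible. -/
def place : LoopProg :=
  .mark (all [(vec 8 (x 0)).not, (vec 1 (x 0)).not]) 10 (x 0) (.const 0)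

/-- Enlarges the independent set in the array `10`. -/
def enlarge : LoopProg :=
  .loop false (.seq scan place)

/-- Writes the output. -/
def output : LoopProg :=
  .loop false (.mark (vec 10 (x 0)).not 3 (x 0) (.const 0))

/-- The loops of the algorithm. -/
def main : LoopProg :=
  .seq near (.seq dominating (.seq conflict (.seq implication (.seq closure (.seq test
    (.seq decideAll (.seq pick (.seq enlarge output))))))))

/-- The algorithm for Monopolar Extension. -/
def program : Prog :=
  .seq (.assign 2 (.add (.var 0) (.var 0))) (.seq (main.compile 10)
    (.assign 1 (.sub (.const 1) (.load 7 (.const 0) (.const 0)))))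

end Program

/-! ### Correctness of the parts -/

open Program Marks

theorem exists_lt_iff_fin {n : ℕ} {P : ℕ → Prop} : (∃ k < n, P k) ↔ ∃ k : Fin n, P k := by
  simp [Fin.exists_iff]

/-- The arrays hold the input. -/
structure Holds {n : ℕ} (G : SimpleGraph (Fin n)) (C' I' : Set (Fin n)) (A : Arrays) : Prop where
  adj : ∀ u v : Fin n, A 0 u v = 0 ↔ ¬ G.Adj u v
  left : ∀ u : Fin n, A 1 u 0 = 0 ↔ u ∉ C'
  right : ∀ u : Fin n, A 2 u 0 = 0 ↔ u ∉ I'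

section

variable {n : ℕ} {G : SimpleGraph (Fin n)} {C' I' : Set (Fin n)} {A : Arrays} {env : ℕ → ℕ}

theorem Holds.congr {B : Arrays} (h : Holds G C' I' A) (h0 : B 0 = A 0) (h1 : B 1 = A 1)
    (h2 : B 2 = A 2) : Holds G C' I' B :=
  ⟨by rw [h0]; exact h.adj, by rw [h1]; exact h.left, by rw [h2]; exact h.right⟩

theorem den_of_ne {p : LoopProg} {a b : ℕ} (hp : p.WritesOnly a) (hb : b ≠ a) (d : ℕ) :
    p.den d env A b = A b := by
  rw [hp.den_eq, Arrays.mark_of_ne hb]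

theorem den_eq_zero {p : LoopProg} {a i j : ℕ} (hp : p.WritesOnly a) (ha : A a = 0) (d : ℕ) :
    p.den d env A a i j = 0 ↔ ¬ p.marked A d env i j := by
  rw [← not_iff_not, not_not, ← ne_eq, hp.den_eq, Arrays.mark_ne_zero]
  simp [ha]

theorem near_writesOnly : near.WritesOnly 5 := by
  simp [near, LoopProg.WritesOnly, Expr.Avoids, Expr.and, Expr.not]

theorem den_near (h : Holds G C' I' A) (hn : env 0 = n) (h5 : A 5 = 0) (b : Fin n) :
    near.den 10 env A 5 b 0 = 0 ↔ ¬ NearModulator G C' b := by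
  rw [den_eq_zero near_writesOnly h5, not_iff_not]
  simp only [near, LoopProg.marked, LoopProg.lengthVar]
  simp [hn, exists_lt_iff_fin, h.adj, h.left, Fin.val_inj, NearModulator]
  grind

theorem dominating_writesOnly : dominating.WritesOnly 6 := by
  simp [dominating, LoopProg.WritesOnly, Expr.Avoids, Expr.and, Expr.not]

theorem den_dominating (h : Holds G C' I' A) (hn : env 0 = n) (h6 : A 6 = 0) (b : Fin n) :
    dominating.den 10 env A 6 b 0 = 0 ↔ ¬ DominatesPath G b := by
  rw [den_eq_zero dominating_writesOnly h6, not_iff_not]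
  simp only [dominating, LoopProg.marked, LoopProg.lengthVar]
  simp [hn, exists_lt_iff_fin, h.adj, Fin.val_inj, DominatesPath]

theorem conflict_writesOnly : conflict.WritesOnly 9 := by
  simp [conflict, LoopProg.WritesOnly, Expr.Avoids, Expr.and, Expr.not, Expr.or]

theorem den_conflict (h : Holds G C' I' A) (hn : env 0 = n) (h9 : A 9 = 0)
    (h5 : ∀ b : Fin n, A 5 b 0 = 0 ↔ ¬ NearModulator G C' b)
    (h6 : ∀ b : Fin n, A 6 b 0 = 0 ↔ ¬ DominatesPath G b) (u v : Fin n) :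
    conflict.den 10 env A 9 u v = 0 ↔ ¬ Conflict G C' u v := by
  rw [den_eq_zero conflict_writesOnly h9, not_iff_not]
  simp only [conflict, LoopProg.marked, LoopProg.lengthVar]
  simp [hn, exists_lt_iff_fin, h.adj, h.left, h5, h6, Fin.val_inj, exists_or]
  simp only [Conflict, PathConflict, PawConflict, ForcedConflict, ClawConflict]
  grind

theorem implication_writesOnly : implication.WritesOnly 4 := by
  simp [implication, LoopProg.WritesOnly, Expr.Avoids, Expr.and, Expr.not, Expr.or]

/-- The pairs of vertices that cannot both be in the independent part, read from the arrays. -/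
def Positive (A : Arrays) (u v : ℕ) : Prop :=
  A 0 u v ≠ 0 ∨ u = v ∧ (A 1 u 0 ≠ 0 ∨ A 6 u 0 ≠ 0)

/-- The pairs of vertices that cannot both be in the cluster part, read from the arrays. -/
def Negative (A : Arrays) (u v : ℕ) : Prop :=
  (A 9 u v ≠ 0 ∨ A 9 v u ≠ 0) ∨ u = v ∧ A 2 u 0 ≠ 0

theorem den_implication (hn : env 0 = n) (hn2 : env 2 = 2 * n) (h4 : A 4 = 0) (i j : ℕ) :
    implication.den 10 env A 4 i j ≠ 0 ↔
      TwoSat.Implication n (Positive A) (Negative A) i j := by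
  rw [ne_eq, den_eq_zero implication_writesOnly h4, not_not]
  simp only [implication, LoopProg.marked, LoopProg.lengthVar]
  simp [hn, hn2, TwoSat.Implication, Positive, Negative]
  refine or_congr (or_congr ?_ Iff.rfl) Iff.rfl
  constructor <;> rintro ⟨h, rfl⟩ <;> exact ⟨h, rfl⟩

/-- One pass that composes the relation in the array `4` with itself through `p` and `q`. -/
theorem den_compose {e : Expr} {p q : ℕ} {c : Prop} (hn2 : env 2 = 2 * n)
    (he : ∀ B : Arrays, (∀ i, B 4 i p ≠ 0 ↔ A 4 i p ≠ 0) → (∀ j, B 4 q j ≠ 0 ↔ A 4 q j ≠ 0) →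
      ∀ i j, e.Holds ⟨Function.update (Function.update env 11 i) 12 j, B⟩ ↔
        c ∧ A 4 i p ≠ 0 ∧ A 4 q j ≠ 0) :
    (LoopProg.loop true (.loop true (.mark e 4 (x 1) (x 2)))).den 11 env A =
      A.mark 4 fun i j => ∃ k < 2 * n, ∃ l < 2 * n,
        (c ∧ A 4 k p ≠ 0 ∧ A 4 q l ≠ 0) ∧ i = k ∧ j = l := by
  have := (Marks.loop (w := true) (d := 11) (env := env) (a := 4)
    (S := fun B => (∀ i, B 4 i p ≠ 0 ↔ A 4 i p ≠ 0) ∧ (∀ j, B 4 q j ≠ 0 ↔ A 4 q j ≠ 0))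
    fun k _ => Marks.loop (w := true) fun l _ => Marks.mark (e := e) (i := x 1) (j := x 2)
      (c := c ∧ A 4 k p ≠ 0 ∧ A 4 q l ≠ 0) (u := k) (v := l)
      (fun B hB => he B hB.1 hB.2 k l) (fun B _ => by simp) (fun B _ => by simp)
      (by
        -- A mark in column p or row q falls on an entry that is already nonzero, so the pass does
        -- not disturb what it reads.
        rintro B ⟨h1, h2⟩ ⟨-, hk, hl⟩
        simp only [Arrays.mark_ne_zero, h1, h2]
        exact ⟨fun i => ⟨by rintro (h | ⟨rfl, rfl⟩) <;> assumption, .inl⟩,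
          fun j => ⟨by rintro (h | ⟨rfl, rfl⟩) <;> assumption, .inl⟩⟩)) A
      ⟨fun _ => Iff.rfl, fun _ => Iff.rfl⟩
  have := this.1
  simpa [LoopProg.lengthVar, hn2] using this

/-- The relation in the array `4`. -/
def Rel (A : Arrays) (i j : ℕ) : Prop := A 4 i j ≠ 0

/-- Warshall's algorithm: after m passes the relation is closed under composition through every
literal below m, and it stays inside the transitive closure. -/
theorem den_closure (hn2 : env 2 = 2 * n)
    (hlt : ∀ i j, Rel A i j → i < 2 * n ∧ j < 2 * n) :
    (∀ a, a ≠ 4 → closure.den 10 env A a = A a) ∧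
      ∀ i j, Rel (closure.den 10 env A) i j ↔ Relation.TransGen (Rel A) i j := by
  have key := LoopProg.den_loop_induction true (.loop true (.loop true
    (.mark (all [.load 4 (x 1) (x 0), .load 4 (x 0) (x 2)]) 4 (x 1) (x 2)))) 10 env A
    (fun m B => (∀ a, a ≠ 4 → B a = A a) ∧ (∀ i j, Rel A i j → Rel B i j) ∧
      (∀ i j, Rel B i j → Relation.TransGen (Rel A) i j) ∧
      ∀ k < m, ∀ i j, Rel B i k → Rel B k j → Rel B i j)
    ⟨fun _ _ => rfl, fun _ _ h => h, fun _ _ h => .single h, by simp⟩ ?_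
  · obtain ⟨h1, h2, h3, h4⟩ := key
    refine ⟨h1, fun i j => ⟨h3 i j, fun h => ?_⟩⟩
    induction h with
    | single h => exact h2 _ _ h
    | tail _ h ih =>
      exact h4 _ (by simpa [LoopProg.lengthVar, hn2] using (hlt _ _ h).1) _ _ ih (h2 _ _ h)
  · rintro k - B ⟨h1, h2, h3, h4⟩
    have hB : ∀ i j, Rel B i j → i < 2 * n ∧ j < 2 * n := by
      intro i j h
      have := h3 i j h
      clear h
      induction this with
      | single h => exact hlt _ _ h
      | tail _ h ih => exact ⟨ih.1, (hlt _ _ h).2⟩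
    rw [den_compose (A := B) (p := k) (q := k) (c := True) (n := n) (by simpa using hn2)
      (by
        intro B' h5 h6 i j
        have h5 := h5 i
        have h6 := h6 j
        simp_all)]
    have hR : ∀ i j, Rel (B.mark 4 fun i j => ∃ k' < 2 * n, ∃ l < 2 * n,
        (True ∧ B 4 k' k ≠ 0 ∧ B 4 k l ≠ 0) ∧ i = k' ∧ j = l) i j ↔
        Rel B i j ∨ (Rel B i k ∧ Rel B k j) := by
      intro i j
      rw [Rel, Arrays.mark_ne_zero]
      refine or_congr Iff.rfl ⟨?_, fun h => ⟨i, (hB _ _ h.1).1, j, (hB _ _ h.2).2, ⟨trivial, h⟩,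
        rfl, rfl⟩⟩
      rintro ⟨k', -, l, -, ⟨-, h⟩, rfl, rfl⟩
      exact h
    refine ⟨fun a ha => by rw [Arrays.mark_of_ne ha, h1 a ha], ?_, ?_, ?_⟩
    · exact fun i j h => (hR i j).2 (.inl (h2 i j h))
    · intro i j h
      rcases (hR i j).1 h with h | ⟨h, h'⟩
      exacts [h3 i j h, (h3 _ _ h).trans (h3 _ _ h')]
    · intro l hl i j
      rw [hR, hR, hR]
      rcases Nat.lt_succ_iff_lt_or_eq.1 hl with hl | rfl
      · have := h4 l hl
        grind
      · grind

theorem den_decideAll (hn : env 0 = n) (hn2 : env 2 = 2 * n)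
    (hA : TwoSat.IsImplicationOrder n (Rel A)) (hc : TwoSat.Consistent n (Rel A)) :
    (∀ a, a ≠ 4 → decideAll.den 10 env A a = A a) ∧
      (∀ i j, Rel A i j → Rel (decideAll.den 10 env A) i j) ∧
      TwoSat.IsImplicationOrder n (Rel (decideAll.den 10 env A)) ∧
      TwoSat.Consistent n (Rel (decideAll.den 10 env A)) ∧
      ∀ u < n, Rel (decideAll.den 10 env A) u (u + n) ∨ Rel (decideAll.den 10 env A) (u + n) u := by
  have key := LoopProg.den_loop_induction false (.loop true (.loop true
    (.mark (all [(Expr.load 4 (x 0) (negLit (x 0))).not,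
    .load 4 (x 1) (negLit (x 0)), .load 4 (x 0) (x 2)]) 4 (x 1) (x 2)))) 10 env A
    (fun m B => (∀ a, a ≠ 4 → B a = A a) ∧ (∀ i j, Rel A i j → Rel B i j) ∧
      TwoSat.IsImplicationOrder n (Rel B) ∧ TwoSat.Consistent n (Rel B) ∧
      ∀ u < m, Rel B u (u + n) ∨ Rel B (u + n) u)
    ⟨fun _ _ => rfl, fun _ _ h => h, hA, hc, by simp⟩ ?_
  · rwa [show env (LoopProg.lengthVar false) = n from hn] at key
  · rintro k hk B ⟨h1, h2, h3, h4, h5⟩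
    replace hk : k < n := by rwa [show env (LoopProg.lengthVar false) = n from hn] at hk
    rw [den_compose (A := B) (p := k + n) (q := k) (c := ¬ Rel B k (k + n)) (n := n)
      (by simpa using hn2)
      (by
        intro B' h5 h6 i j
        have h5 := h5 i
        have h7 := h6 (k + n)
        have h6 := h6 j
        simp_all [Rel])]
    set B' := B.mark 4 fun i j => ∃ k' < 2 * n, ∃ l < 2 * n,
        (¬ Rel B k (k + n) ∧ B 4 k' (k + n) ≠ 0 ∧ B 4 k l ≠ 0) ∧ i = k' ∧ j = l with hB'
    have hR : Rel B' = TwoSat.decideLiteral n k (Rel B) := by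
      funext i j
      rw [Rel, Arrays.mark_ne_zero, TwoSat.decideLiteral, eq_iff_iff]
      refine or_congr Iff.rfl ⟨?_, fun h => ⟨i, (h3.lt _ _ h.2.1).1, j, (h3.lt _ _ h.2.2).2, h,
        rfl, rfl⟩⟩
      rintro ⟨k', -, l, -, h, rfl, rfl⟩
      exact h
    rw [hR]
    refine ⟨fun a ha => by rw [hB', Arrays.mark_of_ne ha, h1 a ha], fun i j h => .inl (h2 i j h),
      h3.decideLiteral hk, h4.decideLiteral h3 k, fun u hu => ?_⟩
    rcases Nat.lt_succ_iff_lt_or_eq.1 hu with hu | rfl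
    · exact (h5 u hu).imp .inl .inl
    · exact TwoSat.decideLiteral_total h3 hk

theorem test_writesOnly : test.WritesOnly 7 := by
  simp [test, LoopProg.WritesOnly, Expr.Avoids, Expr.and, Expr.not]

theorem den_test (hn : env 0 = n) (h7 : A 7 = 0) :
    test.den 10 env A 7 0 0 = 0 ↔ TwoSat.Consistent n (Rel A) := by
  rw [den_eq_zero test_writesOnly h7]
  simp only [test, LoopProg.marked, LoopProg.lengthVar]
  simp [hn, TwoSat.Consistent, Rel]

theorem pick_writesOnly : pick.WritesOnly 10 := by
  simp [pick, LoopProg.WritesOnly, Expr.Avoids]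

theorem den_pick (hn : env 0 = n) (hA : A 10 = 0) (u : Fin n) :
    pick.den 10 env A 10 u 0 ≠ 0 ↔ Rel A u (u + n) := by
  rw [ne_eq, den_eq_zero pick_writesOnly hA, not_not]
  simp only [pick, LoopProg.marked, LoopProg.lengthVar]
  simp [hn, Rel]

theorem output_writesOnly : output.WritesOnly 3 := by
  simp [output, LoopProg.WritesOnly, Expr.Avoids, Expr.not]

theorem den_output (hn : env 0 = n) (hA : A 3 = 0) (u : Fin n) :
    output.den 10 env A 3 u 0 = if A 10 u 0 = 0 then 1 else 0 := by
  rw [output_writesOnly.den_eq]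
  simp only [output, LoopProg.marked, LoopProg.lengthVar, Arrays.mark]
  simp [hn, hA]

theorem scan_writesOnly : scan.WritesOnly 8 := by
  simp [scan, LoopProg.WritesOnly, Expr.Avoids, Expr.and, Expr.not]

theorem place_writesOnly : place.WritesOnly 10 := by
  simp [place, LoopProg.WritesOnly, Expr.Avoids, Expr.and, Expr.not]

/-- The vertices in the array `10`. -/
def marks (n : ℕ) (A : Arrays) : Set (Fin n) := {u | A 10 u 0 ≠ 0}

/-- One greedy pass suffices: the set only grows, so a neighbour that blocks a vertex at its turn
remains. Entries of the array `8` are never cleared, but each is still zero when its vertex is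
reached. -/
theorem den_enlarge (h : Holds G C' I' A) (hn : env 0 = n) (h8 : A 8 = 0)
    (hind : ∀ u v, G.Adj u v → ¬ (u ∈ marks n A ∧ v ∈ marks n A))
    (hC : ∀ u ∈ C', u ∉ marks n A) :
    (∀ a, a ≠ 8 → a ≠ 10 → enlarge.den 10 env A a = A a) ∧
      marks n A ⊆ marks n (enlarge.den 10 env A) ∧
      (∀ u v, G.Adj u v →
        ¬ (u ∈ marks n (enlarge.den 10 env A) ∧ v ∈ marks n (enlarge.den 10 env A))) ∧
      (∀ u ∈ C', u ∉ marks n (enlarge.den 10 env A)) ∧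
      ∀ v, v ∉ C' → v ∉ marks n (enlarge.den 10 env A) →
        ∃ w ∈ marks n (enlarge.den 10 env A), G.Adj v w := by
  have key := LoopProg.den_loop_induction false (.seq scan place) 10 env A
    (fun m B => (∀ u : Fin n, m ≤ u → B 8 u 0 = 0) ∧ (∀ a, a ≠ 8 → a ≠ 10 → B a = A a) ∧
      marks n A ⊆ marks n B ∧ (∀ u v, G.Adj u v → ¬ (u ∈ marks n B ∧ v ∈ marks n B)) ∧
      (∀ u ∈ C', u ∉ marks n B) ∧
      ∀ v : Fin n, (v : ℕ) < m → v ∉ C' → v ∉ marks n B → ∃ w ∈ marks n B, G.Adj v w)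
    ⟨fun u _ => by simp [h8], fun _ _ _ => rfl, subset_rfl, hind, hC, by simp⟩ ?_
  · obtain ⟨-, h1, h2, h3, h4, h5⟩ := key
    rw [show env (LoopProg.lengthVar false) = n from hn] at h5
    exact ⟨h1, h2, h3, h4, fun v => h5 v v.2⟩
  · rintro k hk B ⟨h0, h1, h2, h3, h4, h5⟩
    replace hk : k < n := by rwa [show env (LoopProg.lengthVar false) = n from hn] at hk
    obtain ⟨k, rfl⟩ : ∃ k' : Fin n, (k' : ℕ) = k := ⟨⟨k, hk⟩, rfl⟩
    have hB : Holds G C' I' B := h.congr (h1 0 (by simp) (by simp)) (h1 1 (by simp) (by simp))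
      (h1 2 (by simp) (by simp))
    rw [LoopProg.den, scan_writesOnly.den_eq]
    set D := B.mark 8 _ with hD
    have hDne : ∀ a, a ≠ 8 → D a = B a := fun a ha => Arrays.mark_of_ne ha _ _
    have hD8 : ∀ u : Fin n, D 8 u 0 ≠ 0 ↔
        B 8 u 0 ≠ 0 ∨ (u = k ∧ ∃ w ∈ marks n B, G.Adj k w) := by
      intro u
      rw [hD, Arrays.mark_ne_zero]
      simp only [scan, LoopProg.marked, LoopProg.lengthVar]
      simp [hn, exists_lt_iff_fin, Fin.val_inj, hB.adj, marks]
      grind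
    rw [place_writesOnly.den_eq]
    set E := D.mark 10 _ with hE
    have hEne : ∀ a, a ≠ 10 → E a = D a := fun a ha => Arrays.mark_of_ne ha _ _
    have hk8 := hD8 k
    have hkB : B 8 k 0 = 0 := h0 k le_rfl
    have hE10 : ∀ u : Fin n, u ∈ marks n E ↔
        u ∈ marks n B ∨ (u = k ∧ (¬ ∃ w ∈ marks n B, G.Adj k w) ∧ k ∉ C') := by
      intro u
      rw [marks, Set.mem_ofPred_eq, hE, Arrays.mark_ne_zero, hDne 10 (by simp)]
      refine or_congr Iff.rfl ?_
      simp only [place, LoopProg.marked]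
      have : D 1 k 0 = 0 ↔ k ∉ C' := by rw [hDne 1 (by simp)]; exact hB.left k
      simp [Fin.val_inj, this]
      grind
    refine ⟨?_, ?_, ?_, ?_, ?_, ?_⟩
    · intro u hu
      have := hD8 u
      rw [hEne 8 (by simp)]
      by_contra h
      rcases this.1 h with h | ⟨rfl, -⟩
      · exact h (h0 u (by omega))
      · omega
    · intro a h8 h10
      rw [hEne a h10, hDne a h8, h1 a h8 h10]
    · exact fun u hu => (hE10 u).2 (.inl (h2 hu))
    · intro u v huv
      rw [hE10, hE10]
      rintro ⟨hu | ⟨rfl, hu, -⟩, hv | ⟨rfl, hv, -⟩⟩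
      exacts [h3 u v huv ⟨hu, hv⟩, hv ⟨u, hu, huv.symm⟩, hu ⟨v, hv, huv⟩, huv.ne rfl]
    · intro u hu
      rw [hE10]
      rintro (h | ⟨rfl, -, h⟩)
      exacts [h4 u hu h, h hu]
    · intro v hv hvC hvE
      rw [hE10] at hvE
      have hvB : v ∉ marks n B := fun h => hvE (.inl h)
      suffices ∃ w ∈ marks n B, G.Adj v w from
        this.imp fun w hw => ⟨(hE10 w).2 (.inl hw.1), hw.2⟩
      by_cases hvk : v = k
      · subst hvk
        by_contra h
        exact hvE (.inr ⟨rfl, h, hvC⟩)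
      · exact h5 v (by have := Fin.val_ne_of_ne hvk; omega) hvC hvB

/-! ### Correctness of the algorithm -/

/-- The test passes exactly when the clauses are satisfiable, and then the output is an extension.
Chair-freeness plays no role here. -/
theorem main_correct (h : Holds G C' I' A) (hn : env 0 = n) (hn2 : env 2 = 2 * n)
    (hA : ∀ a, 2 < a → A a = 0) :
    ((∃ J, SatisfiesClauses G C' I' J) → main.den 10 env A 7 0 0 = 0) ∧
      (main.den 10 env A 7 0 0 = 0 → ∃ K, IsMonopolarExtension G C' I' Kᶜ K ∧
        ∀ u : Fin n, (u ∉ K → main.den 10 env A 3 u 0 = 1) ∧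
          (u ∈ K → main.den 10 env A 3 u 0 = 0)) := by
  simp only [main, LoopProg.den]
  have s1 := den_near h hn (hA 5 (by simp))
  have f1 : ∀ a, a ≠ 5 → near.den 10 env A a = A a := fun a ha => den_of_ne near_writesOnly ha 10
  generalize near.den 10 env A = A1 at *
  have h1 : Holds G C' I' A1 := h.congr (f1 _ (by simp)) (f1 _ (by simp)) (f1 _ (by simp))
  have s2 := den_dominating h1 hn (by rw [f1, hA] <;> simp)
  have f2 : ∀ a, a ≠ 6 → dominating.den 10 env A1 a = A1 a :=
    fun a ha => den_of_ne dominating_writesOnly ha 10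
  generalize dominating.den 10 env A1 = A2 at *
  have h2 : Holds G C' I' A2 := h1.congr (f2 _ (by simp)) (f2 _ (by simp)) (f2 _ (by simp))
  have s3 := den_conflict h2 hn (by rw [f2, f1, hA] <;> simp)
    (by rw [f2 5 (by simp)]; exact s1) s2
  have f3 : ∀ a, a ≠ 9 → conflict.den 10 env A2 a = A2 a :=
    fun a ha => den_of_ne conflict_writesOnly ha 10
  generalize conflict.den 10 env A2 = A3 at *
  have h3 : Holds G C' I' A3 := h2.congr (f3 _ (by simp)) (f3 _ (by simp)) (f3 _ (by simp))
  have hpos : ∀ u v : Fin n, Positive A3 u v ↔ G.Adj u v ∨ u = v ∧ Forced G C' u := by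
    intro u v
    rw [Positive, Forced, ne_eq, ne_eq, ne_eq, h3.adj, h3.left, f3 6 (by simp), s2, Fin.val_inj]
    simp only [not_not]
  have hneg : ∀ u v : Fin n, Negative A3 u v ↔
      (Conflict G C' u v ∨ Conflict G C' v u) ∨ u = v ∧ u ∈ I' := by
    intro u v
    rw [Negative, ne_eq, ne_eq, ne_eq, s3, s3, h3.right, Fin.val_inj]
    simp only [not_not]
  have s4 := den_implication (A := A3) hn hn2 (by rw [f3, f2, f1, hA] <;> simp)
  have f4 : ∀ a, a ≠ 4 → implication.den 10 env A3 a = A3 a :=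
    fun a ha => den_of_ne implication_writesOnly ha 10
  generalize implication.den 10 env A3 = A4 at *
  have hrel : Rel A4 = TwoSat.Implication n (Positive A3) (Negative A3) := by
    funext i j
    exact propext (s4 i j)
  have hT : TwoSat.IsImplicationOrder n
      (Relation.TransGen (TwoSat.Implication n (Positive A3) (Negative A3))) := by
    refine TwoSat.isImplicationOrder_transGen (fun u hu v hv huv => ?_) (fun u hu v hv huv => ?_)
    · have := (hpos ⟨u, hu⟩ ⟨v, hv⟩).1 huv
      refine (hpos ⟨v, hv⟩ ⟨u, hu⟩).2 (this.imp .symm ?_)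
      rintro ⟨h, h'⟩
      exact ⟨h.symm, h ▸ h'⟩
    · have := (hneg ⟨u, hu⟩ ⟨v, hv⟩).1 huv
      refine (hneg ⟨v, hv⟩ ⟨u, hu⟩).2 (this.imp .symm ?_)
      rintro ⟨h, h'⟩
      exact ⟨h.symm, h ▸ h'⟩
  obtain ⟨f5, s5⟩ := den_closure (A := A4) hn2
    (fun i j hij => hT.lt i j (.single (hrel ▸ hij)))
  generalize closure.den 10 env A4 = A5 at *
  have hrel5 : Rel A5 =
      Relation.TransGen (TwoSat.Implication n (Positive A3) (Negative A3)) := by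
    funext i j
    rw [← hrel]
    exact propext (s5 i j)
  have s6 := den_test (A := A5) hn (by rw [f5, f4, f3, f2, f1, hA] <;> simp)
  have f6 : ∀ a, a ≠ 7 → test.den 10 env A5 a = A5 a :=
    fun a ha => den_of_ne test_writesOnly ha 10
  generalize test.den 10 env A5 = A6 at *
  have hrel6 : Rel A6 = Rel A5 := by
    unfold Rel
    rw [f6 4 (by simp)]
  have f7 : decideAll.den 10 env A6 7 = A6 7 :=
    LoopProg.Preserves.den_eq (by simp [decideAll, LoopProg.Preserves]) 10 env A6
  have f8 : ∀ B, pick.den 10 env B 7 = B 7 := LoopProg.Preserves.den_eq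
    (by simp [pick, LoopProg.Preserves]) 10 env
  have f9 : ∀ B, enlarge.den 10 env B 7 = B 7 := LoopProg.Preserves.den_eq
    (by simp [enlarge, scan, place, LoopProg.Preserves]) 10 env
  have f10 : ∀ B, output.den 10 env B 7 = B 7 := LoopProg.Preserves.den_eq
    (by simp [output, LoopProg.Preserves]) 10 env
  -- No phase after the test writes to the array `7`, so its final entry still records consistency.
  rw [f10, f9, f8, f7, s6, hrel5]
  clear f7 f8 f9 f10
  refine ⟨?_, fun hc => ?_⟩
  · rintro ⟨J, hJ⟩
    refine TwoSat.consistent_transGen_of_model (J := fun u => ∃ h : u < n, ⟨u, h⟩ ∈ J) ?_ ?_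
    · rintro u hu v hv huv ⟨⟨_, hu'⟩, ⟨_, hv'⟩⟩
      rcases (hpos ⟨u, hu⟩ ⟨v, hv⟩).1 huv with h | ⟨-, h⟩
      exacts [hJ.indep _ _ h ⟨hu', hv'⟩, hJ.forced _ h hu']
    · intro u hu v hv huv
      simp only [hu, hv, exists_true_left]
      rcases (hneg ⟨u, hu⟩ ⟨v, hv⟩).1 huv with (h | h) | ⟨-, h⟩
      exacts [hJ.conflict _ _ h, (hJ.conflict _ _ h).symm, .inl (hJ.subset _ h)]
  · obtain ⟨f7, s7, hord, hcons, htot⟩ := den_decideAll (A := A6) hn hn2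
      (by rw [hrel6, hrel5]; exact hT) (by rw [hrel6, hrel5]; exact hc)
    generalize decideAll.den 10 env A6 = A7 at *
    obtain ⟨m1, m2⟩ := hord.model hcons htot (pos := Positive A3) (ng := Negative A3)
      fun i j hij => s7 i j (by rw [hrel6, hrel5]; exact .single hij)
    have s8 := den_pick (A := A7) hn (by rw [f7, f6, f5, f4, f3, f2, f1, hA] <;> simp)
    have f8 : ∀ a, a ≠ 10 → pick.den 10 env A7 a = A7 a :=
      fun a ha => den_of_ne pick_writesOnly ha 10
    generalize pick.den 10 env A7 = A8 at *
    have h8 : Holds G C' I' A8 := h3.congr (by rw [f8, f7, f6, f5, f4] <;> simp)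
      (by rw [f8, f7, f6, f5, f4] <;> simp) (by rw [f8, f7, f6, f5, f4] <;> simp)
    have hsat : SatisfiesClauses G C' I' (marks n A8) := by
      have hmem : ∀ u : Fin n, u ∈ marks n A8 ↔ Rel A7 u (u + n) := s8
      refine ⟨fun u v huv => ?_, fun u hu hu' => ?_, fun u hu => ?_, fun u v huv => ?_⟩
      · rw [hmem, hmem]
        exact m1 u u.2 v v.2 ((hpos u v).2 (.inl huv))
      -- Unit clauses were entered as clauses with the same literal twice.
      · rw [hmem] at hu'
        exact m1 u u.2 u u.2 ((hpos u u).2 (.inr ⟨rfl, hu⟩)) ⟨hu', hu'⟩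
      · rw [hmem]
        exact (or_self_iff).1 (m2 u u.2 u u.2 ((hneg u u).2 (.inr ⟨rfl, hu⟩)))
      · rw [hmem, hmem]
        exact m2 u u.2 v v.2 ((hneg u v).2 (.inl (.inl huv)))
    obtain ⟨f9, t1, t2, t3, t4⟩ := den_enlarge h8 hn
      (by rw [f8, f7, f6, f5, f4, f3, f2, f1, hA] <;> simp) hsat.indep
      (fun u hu => hsat.forced u (.inl hu))
    generalize enlarge.den 10 env A8 = A9 at *
    refine ⟨marks n A9, hsat.isMonopolarExtension t1 t2 t3 t4, fun u => ?_⟩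
    rw [den_output hn (by rw [f9, f8, f7, f6, f5, f4, f3, f2, f1, hA] <;> simp)]
    exact ⟨fun hu => if_pos (not_not.1 hu), fun hu => if_neg hu⟩

end

open Classical in
theorem holds_inputState {n : ℕ} (G : SimpleGraph (Fin n)) (C' I' : Set (Fin n)) :
    Holds G C' I' (inputState G C' I').arr := by
  refine ⟨fun u v => ?_, fun u => ?_, fun u => ?_⟩ <;> simp [inputState, Fin.val_inj]

end Monopolar

theorem theorem5 :
    ∃ (P : RAM.Prog) (p : Polynomial ℕ),
      ∀ (n : ℕ) (G : SimpleGraph (Fin n)) (C' I' : Set (Fin n)),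
        Monopolar.IsChairFreeModulator G C' →
          ∃ (t : ℕ) (s : RAM.State),
            RAM.Exec P (Monopolar.inputState G C' I') t s ∧
            t ≤ p.eval n ∧
            (Monopolar.MonopolarExtendable G C' I' →
              Monopolar.AnswersYes s ∧
              ∃ C I : Set (Fin n),
                Monopolar.IsMonopolarExtension G C' I' C I ∧ Monopolar.OutputsPartition s C I) ∧
            (¬ Monopolar.MonopolarExtendable G C' I' → Monopolar.AnswersNo s) := by
  -- The assignments before and after the loops take 4 and 6 steps, so 12 is ample.
  refine ⟨Monopolar.Program.program, Polynomial.C 12 + Monopolar.Program.main.cost,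
    fun n G C' I' hmod => ?_⟩
  set s := Monopolar.inputState G C' I' with hs
  set env := Function.update s.var 2 (n + n) with henv
  have hvar : ∀ x, s.var x = if x = 0 then n else 0 := fun x => rfl
  have hn : env 0 = n := by simp [henv, hvar]
  have hn2 : env 2 = 2 * n := by simp [henv, two_mul]
  have e1 : RAM.Exec (.assign 2 (.add (.var 0) (.var 0))) s 4 ⟨env, s.arr⟩ := by
    have := RAM.Exec.assign s 2 (.add (.var 0) (.var 0))
    rwa [show s.setVar 2 _ = ⟨env, s.arr⟩ by
      ext y
      · by_cases h : y = 2 <;> simp [RAM.State.setVar, henv, h, hvar]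
      · rfl] at this
  obtain ⟨t, e2, ht⟩ := RAM.LoopProg.exec_compile Monopolar.Program.main 10 env s.arr (by simp)
    (by rw [hn, hn2]) (fun x hx => by
      rw [henv, Function.update_of_ne (by omega), hvar, if_neg (by omega)])
  have e3 := RAM.Exec.assign ⟨env, Monopolar.Program.main.den 10 env s.arr⟩ 1
    (.sub (.const 1) (.load 7 (.const 0) (.const 0)))
  refine ⟨_, _, e1.seq (e2.seq e3), ?_, ?_⟩
  · rw [hn] at ht
    simp only [RAM.Expr.cost, Polynomial.eval_add, Polynomial.eval_C]
    omega
  obtain ⟨c1, c2⟩ := Monopolar.main_correct (Monopolar.holds_inputState G C' I') hn hn2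
    (fun a ha => by
      funext i j
      simp [Monopolar.inputState, show a ≠ 0 by omega, show a ≠ 1 by omega, show a ≠ 2 by omega])
  simp only [Monopolar.AnswersYes, Monopolar.AnswersNo, Monopolar.OutputsPartition,
    RAM.State.setVar, RAM.Expr.eval, if_true]
  constructor
  · intro hext
    have h7 := c1 (hext.exists_satisfiesClauses hmod)
    obtain ⟨K, hK, hout⟩ := c2 h7
    exact ⟨by rw [h7], Kᶜ, K, hK, fun v hv => (hout v).1 hv, fun v hv => (hout v).2 hv⟩
  · intro hext
    have h7 : Monopolar.Program.main.den 10 env s.arr 7 0 0 ≠ 0 := fun h7 => by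
      obtain ⟨K, hK, -⟩ := c2 h7
      exact hext ⟨Kᶜ, K, hK⟩
    omega
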